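/- Let $K \ge 2$ and let $\nu_1,\dots,\nu_K$ be probability distributions on $[-R_{\max}, R_{\max}]$ for some $R_{\max} > 0$ (the reward distributions of the $K$ arms), with means $r(a) = \int x \, \nu_a(dx)$. Assume that there are no ties: $r(i) \ne r(j)$ whenever $i \ne j$. Let $a^* = \operatorname{argmax}_{a \in [K]} r(a)$ be the optimal arm. For $\theta \in \mathbb{R}^K$ let $\pi_\theta(a) = e^{\theta(a)} / \sum_{b \in [K]} e^{\theta(b)}$. Let $\eta > 0$ be an arbitrary constant learning rate and consider the gradient bandit algorithm: it starts from an arbitrary (deterministic or random) $\theta_1 \in \mathbb{R}^K$, and in each iteration $t \ge 1$, given the past (that is, $\theta_1$ and the arms and rewards of the iterations before $t$), it samples an arm $a_t \sim \pi_{\theta_t}(\cdot)$, then observes a reward $R_t \sim \nu_{a_t}$, and sets $$\theta_{t+1}(a) = \begin{cases} \theta_t(a) + \eta \, (1 - \pi_{\theta_t}(a)) \, R_t, & a = a_t, \\ \theta_t(a) - \eta \, \pi_{\theta_t}(a) \, R_t, & a \ne a_t, \end{cases} \qquad a \in [K].$$ Then, almost surely, $\pi_{\theta_t}(a^*) \to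 1$ as $t \to \infty$. -/

import Mathlib

open MeasureTheory ProbabilityTheory Filter Topology

/-- The softmax policy `π_θ` on `K` arms with parameter vector `θ`. -/
noncomputable def softmax {K : ℕ} (θ : Fin K → ℝ) (a : Fin K) : ℝ :=
  Real.exp (θ a) / ∑ b : Fin K, Real.exp (θ b)

/-- The true mean reward `r(a)` of arm `a`, whose reward distribution is `ν a`. -/
noncomputable def meanReward {K : ℕ} (ν : Fin K → Measure ℝ) (a : Fin K) : ℝ :=
  ∫ x, x ∂(ν a)

/-- One update of the gradient bandit algorithm with learning rate `η`, from parameters `θ`,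
after pulling arm `b` and observing the reward `x`. -/
noncomputable def gradientBanditUpdate {K : ℕ} (η : ℝ) (θ : Fin K → ℝ) (b : Fin K) (x : ℝ) :
    Fin K → ℝ :=
  fun a => if a = b then θ a + η * (1 - softmax θ a) * x else θ a - η * softmax θ a * x

/-- `θ`, `A`, `R` are the parameters, pulled arms and observed rewards of a run of the gradient
bandit algorithm with learning rate `η` on the bandit with reward distributions `ν`. Iterations are
numbered from `0`, so `θ 0` is the (arbitrary, possibly random) initialization. The σ-algebra `ℱ t`
contains the information available before the `t`-th pull. -/
structure IsGradientBanditRun {Ω : Type*} {mΩ : MeasurableSpace Ω} (P : Measure Ω)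
    (ℱ : Filtration ℕ mΩ) {K : ℕ} (ν : Fin K → Measure ℝ) (η : ℝ)
    (θ : ℕ → Ω → Fin K → ℝ) (A : ℕ → Ω → Fin K) (R : ℕ → Ω → ℝ) : Prop where
  /-- The initialization is known at the start. -/
  measurable_init : Measurable[ℱ 0] (θ 0)
  /-- The arm pulled in an iteration is known after it. -/
  measurable_arm : ∀ t, Measurable[ℱ (t + 1)] (A t)
  /-- The reward observed in an iteration is known after it. -/
  measurable_reward : ∀ t, Measurable[ℱ (t + 1)] (R t)
  /-- Given the past, the arm is drawn from the softmax policy and then the reward is drawn from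
  the reward distribution of that arm. -/
  condLaw : ∀ (t : ℕ) (a : Fin K) (B : Set ℝ), MeasurableSet B →
    P[({ω | A t ω = a ∧ R t ω ∈ B}).indicator (fun _ => (1 : ℝ)) | ℱ t]
      =ᵐ[P] fun ω => softmax (θ t ω) a * (ν a).real B
  /-- The parameters are updated by the gradient bandit rule. -/
  update : ∀ t ω, θ (t + 1) ω = gradientBanditUpdate η (θ t ω) (A t ω) (R t ω)

/-!
An exponential supermartingale shows that almost every path tracks its drift: for each `ε > 0`,
every parameter `θ a` stays within a constant plus `ε` times its accumulated variance of `η` times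
the accumulated policy gradient. The rest is deterministic. No arm has summable probability:
parameters of such arms are bounded below, while the worst of the other arms would have a parameter
bounded above, as it competes only with better arms up to a summable error. If the accumulated
variance `∑ p (1 - p)` of the best arm is finite, its probability `p` tends to `1`, because bounded
increments exclude a jump from near `0` to near `1`. If it is infinite, the drift sends the
parameter of the best arm to infinity, and every other arm falls infinitely far behind: the worst
one that did not would be beaten by all arms of nonnegligible probability, so its parameter would be
bounded above.
-/

section DriftTracking

lemma bddAbove_sum_range_of_eventually_le {f g : ℕ → ℝ} (hg : Summable g) (h : f ≤ᶠ[atTop] g) :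
    BddAbove (Set.range fun t => ∑ s ∈ Finset.range t, f s) := by
  have hpos : Summable fun t => max (f t) 0 := by
    refine Summable.of_norm_bounded_eventually_nat hg.abs ?_
    filter_upwards [h] with t ht
    rw [Real.norm_of_nonneg (le_max_right _ _)]
    exact max_le (ht.trans (le_abs_self _)) (abs_nonneg _)
  refine ⟨∑' t, max (f t) 0, Set.forall_mem_range.2 fun t => ?_⟩
  calc ∑ s ∈ Finset.range t, f s ≤ ∑ s ∈ Finset.range t, max (f s) 0 :=
        Finset.sum_le_sum fun s _ => le_max_left _ _
    _ ≤ ∑' t, max (f t) 0 := hpos.sum_le_tsum _ fun s _ => le_max_right _ _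

/-- The sequence `y` tracks the drift `d` with variance proxy `v`: it differs from the accumulated
drift by at most an arbitrarily small multiple of the accumulated variance, up to a constant. By
`ae_tracksDrift`, almost every path of a process with bounded increments has this property. -/
def TracksDrift (y d v : ℕ → ℝ) : Prop :=
  ∀ ε > 0, ∃ C, ∀ t, |y t - ∑ s ∈ Finset.range t, d s| ≤ C + ε * ∑ s ∈ Finset.range t, v s

namespace TracksDrift

variable {y d v g : ℕ → ℝ} {c : ℝ}

lemma neg (h : TracksDrift y d v) : TracksDrift (-y) (-d) v := by
  intro ε hε
  obtain ⟨C, hC⟩ := h ε hε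
  refine ⟨C, fun t => ?_⟩
  simpa only [Pi.neg_apply, Finset.sum_neg_distrib, neg_sub_neg, abs_sub_comm] using hC t

lemma const_add (h : TracksDrift y d v) (b : ℝ) : TracksDrift (fun t => b + y t) d v := by
  intro ε hε
  obtain ⟨C, hC⟩ := h ε hε
  refine ⟨|b| + C, fun t => ?_⟩
  rw [add_sub_assoc, add_assoc]
  exact (abs_add_le _ _).trans (by gcongr; exact hC t)

lemma mono_variance {w : ℕ → ℝ} {M : ℝ} (h : TracksDrift y d v) (hM : 0 < M)
    (hvw : ∀ t, v t ≤ M * w t) : TracksDrift y d w := by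
  intro ε hε
  obtain ⟨C, hC⟩ := h (ε / M) (by positivity)
  refine ⟨C, fun t => (hC t).trans ?_⟩
  calc C + ε / M * ∑ s ∈ Finset.range t, v s
      ≤ C + ε / M * ∑ s ∈ Finset.range t, M * w s := by gcongr with s; exact hvw s
    _ = C + ε * ∑ s ∈ Finset.range t, w s := by rw [← Finset.mul_sum]; field_simp

lemma exists_le_sub_mul_sum (h : TracksDrift y d v) (hc : 0 < c) (hg : Summable g)
    (hd : ∀ᶠ t in atTop, d t ≤ -(c * v t) + g t) :
    ∃ C, ∀ t, y t ≤ C - c / 2 * ∑ s ∈ Finset.range t, v s := by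
  obtain ⟨C, hC⟩ := h (c / 2) (half_pos hc)
  obtain ⟨E, hE⟩ := bddAbove_sum_range_of_eventually_le (f := fun t => d t + c * v t) hg
    (hd.mono fun t ht => by linarith)
  refine ⟨C + E, fun t => ?_⟩
  have herror : ∑ s ∈ Finset.range t, d s + c * ∑ s ∈ Finset.range t, v s ≤ E := by
    rw [Finset.mul_sum, ← Finset.sum_add_distrib]
    exact hE ⟨t, rfl⟩
  linarith [(abs_le.1 (hC t)).2]

lemma bddAbove (h : TracksDrift y d v) (hv : 0 ≤ v) (hc : 0 < c) (hg : Summable g)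
    (hd : ∀ᶠ t in atTop, d t ≤ -(c * v t) + g t) : BddAbove (Set.range y) := by
  obtain ⟨C, hC⟩ := h.exists_le_sub_mul_sum hc hg hd
  refine ⟨C, Set.forall_mem_range.2 fun t => (hC t).trans (sub_le_self _ ?_)⟩
  exact mul_nonneg (half_pos hc).le (Finset.sum_nonneg fun s _ => hv s)

lemma bddBelow (h : TracksDrift y d v) (hv : 0 ≤ v) (hc : 0 < c) (hg : Summable g)
    (hd : ∀ᶠ t in atTop, c * v t - g t ≤ d t) : BddBelow (Set.range y) := by
  obtain ⟨C, hC⟩ := h.neg.bddAbove hv hc hg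
    (hd.mono fun t ht => by simp only [Pi.neg_apply]; linarith)
  exact ⟨-C, Set.forall_mem_range.2 fun t => neg_le.1 (hC ⟨t, rfl⟩)⟩

lemma tendsto_atTop (h : TracksDrift y d v) (hv : 0 ≤ v) (hc : 0 < c) (hsum : ¬ Summable v)
    (hd : ∀ᶠ t in atTop, c * v t ≤ d t) : Tendsto y atTop atTop := by
  obtain ⟨C, hC⟩ := h.neg.exists_le_sub_mul_sum hc summable_zero
    (hd.mono fun t ht => by simpa using ht)
  have hV : Tendsto (fun t => ∑ s ∈ Finset.range t, v s) atTop atTop :=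
    (not_summable_iff_tendsto_nat_atTop_of_nonneg hv).1 hsum
  refine tendsto_atTop_mono (fun t => ?_)
    (tendsto_atTop_add_const_left _ (-C) (hV.const_mul_atTop (half_pos hc)))
  have := hC t
  simp only [Pi.neg_apply] at this
  linarith

end TracksDrift

end DriftTracking

section Sequence

/-- A sequence in `[0, 1]` with `p t * (1 - p t) → 0` is eventually near `0` or near `1`. Bounded
growth rules out a jump from near `0` to near `1`, and staying near `0` would make `p` summable. -/
lemma tendsto_one_of_summable_mul_one_sub {p : ℕ → ℝ} {M : ℝ} (h0 : ∀ t, 0 ≤ p t)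
    (h1 : ∀ t, p t ≤ 1) (hM : 0 < M) (hstep : ∀ t, p (t + 1) ≤ M * p t) (hp : ¬ Summable p)
    (hv : Summable fun t => p t * (1 - p t)) : Tendsto p atTop (𝓝 1) := by
  have hlim := hv.tendsto_atTop_zero
  obtain ⟨T, hT⟩ := eventually_atTop.1
    (hlim.eventually_lt_const (show (0 : ℝ) < 1 / (4 * M) by positivity))
  have hdouble : ∀ t, p t < 1 / 2 → p t ≤ 2 * (p t * (1 - p t)) := fun t ht => by
    nlinarith [h0 t]
  have hstay : ∀ t ≥ T, p t < 1 / 2 → p (t + 1) < 1 / 2 := fun t htT ht => by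
    calc p (t + 1) ≤ M * (2 * (p t * (1 - p t))) :=
          (hstep t).trans (by gcongr; exact hdouble t ht)
      _ < M * (2 * (1 / (4 * M))) := by gcongr; exact hT t htT
      _ = 1 / 2 := by field_simp; norm_num
  have hlarge : ∀ t ≥ T, 1 / 2 ≤ p t := by
    intro t htT
    by_contra! ht
    have hsmall : ∀ n ≥ t, p n < 1 / 2 := fun n hn =>
      Nat.le_induction ht (fun k hk => hstay k (htT.trans hk)) n hn
    refine hp (Summable.of_norm_bounded_eventually_nat (hv.mul_left 2) ?_)
    filter_upwards [eventually_ge_atTop t] with n hn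
    rw [Real.norm_of_nonneg (h0 n)]
    exact hdouble n (hsmall n hn)
  have hsub : Tendsto (fun t => 1 - p t) atTop (𝓝 0) := by
    refine squeeze_zero' (Eventually.of_forall fun t => sub_nonneg.2 (h1 t)) ?_
      (by simpa using hlim.const_mul 2)
    filter_upwards [eventually_ge_atTop T] with t ht
    nlinarith [hlarge t ht, h1 t]
  simpa using hsub.const_sub 1

end Sequence

section Softmax

variable {K : ℕ} (θ : Fin K → ℝ)

lemma softmax_pos (a : Fin K) : 0 < softmax θ a :=
  div_pos (Real.exp_pos _)
    (Finset.sum_pos (fun _ _ => Real.exp_pos _) ⟨a, Finset.mem_univ a⟩)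

lemma sum_softmax [Nonempty (Fin K)] : ∑ b, softmax θ b = 1 := by
  simp only [softmax, ← Finset.sum_div]
  exact div_self (Finset.sum_pos (fun _ _ => Real.exp_pos _) Finset.univ_nonempty).ne'

lemma one_sub_softmax (a : Fin K) :
    1 - softmax θ a = ∑ b ∈ Finset.univ.erase a, softmax θ b := by
  have : Nonempty (Fin K) := ⟨a⟩
  rw [← sum_softmax θ, ← Finset.add_sum_erase _ _ (Finset.mem_univ a), add_sub_cancel_left]

lemma softmax_le_one (a : Fin K) : softmax θ a ≤ 1 := by
  rw [← sub_nonneg, one_sub_softmax]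
  exact Finset.sum_nonneg fun b _ => (softmax_pos θ b).le

lemma softmax_le_one_sub_softmax {a b : Fin K} (hab : a ≠ b) :
    softmax θ a ≤ 1 - softmax θ b := by
  rw [one_sub_softmax]
  exact Finset.single_le_sum (fun c _ => (softmax_pos θ c).le)
    (Finset.mem_erase.2 ⟨hab, Finset.mem_univ a⟩)

lemma softmax_eq_exp_sub_mul_softmax (a b : Fin K) :
    softmax θ a = Real.exp (θ a - θ b) * softmax θ b := by
  rw [softmax, softmax, Real.exp_sub]
  field_simp

lemma softmax_le_exp_mul_softmax {θ θ' : Fin K → ℝ} {B : ℝ} (h : ∀ b, |θ' b - θ b| ≤ B)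
    (a : Fin K) : softmax θ' a ≤ Real.exp (2 * B) * softmax θ a := by
  have hexp : ∀ {x y : ℝ}, |x - y| ≤ B → Real.exp x ≤ Real.exp B * Real.exp y := fun hxy => by
    rw [← Real.exp_add, Real.exp_le_exp]
    linarith [(abs_le.1 hxy).2]
  have hsum_pos : ∀ x : Fin K → ℝ, 0 < ∑ b, Real.exp (x b) := fun x =>
    Finset.sum_pos (fun _ _ => Real.exp_pos _) ⟨a, Finset.mem_univ a⟩
  have hsum : ∑ b, Real.exp (θ b) ≤ Real.exp B * ∑ b, Real.exp (θ' b) := by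
    rw [Finset.mul_sum]
    exact Finset.sum_le_sum fun b _ => hexp (abs_sub_comm (θ b) (θ' b) ▸ h b)
  rw [softmax, softmax, ← mul_div_assoc, div_le_div_iff₀ (hsum_pos θ') (hsum_pos θ), two_mul,
    Real.exp_add]
  calc Real.exp (θ' a) * ∑ b, Real.exp (θ b)
      ≤ (Real.exp B * Real.exp (θ a)) * (Real.exp B * ∑ b, Real.exp (θ' b)) := by
        gcongr
        exact hexp (h a)
    _ = Real.exp B * Real.exp B * Real.exp (θ a) * ∑ b, Real.exp (θ' b) := by ring

lemma measurable_softmax (a : Fin K) : Measurable fun θ : Fin K → ℝ => softmax θ a := by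
  unfold softmax
  fun_prop

variable {ι : Type*} {l : Filter ι} {x : ι → Fin K → ℝ} {a : Fin K}

lemma eventually_sum_softmax_le_mul {N : Finset (Fin K)}
    (h : ∀ b ∈ N, Tendsto (fun t => x t b - x t a) l atBot) {δ : ℝ} (hδ : 0 < δ) :
    ∀ᶠ t in l, ∑ b ∈ N, softmax (x t) b ≤ δ * softmax (x t) a := by
  have hlim : Tendsto (fun t => ∑ b ∈ N, Real.exp (x t b - x t a)) l (𝓝 0) := by
    simpa using tendsto_finsetSum N fun b hb => Real.tendsto_exp_atBot.comp (h b hb)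
  filter_upwards [hlim.eventually_lt_const hδ] with t ht
  calc ∑ b ∈ N, softmax (x t) b
      = (∑ b ∈ N, Real.exp (x t b - x t a)) * softmax (x t) a := by
        rw [Finset.sum_mul]
        exact Finset.sum_congr rfl fun b _ => softmax_eq_exp_sub_mul_softmax _ _ _
    _ ≤ δ * softmax (x t) a := mul_le_mul_of_nonneg_right ht.le (softmax_pos _ _).le

lemma tendsto_softmax_one (h : ∀ b, b ≠ a → Tendsto (fun t => x t b - x t a) l atBot) :
    Tendsto (fun t => softmax (x t) a) l (𝓝 1) := by
  rw [tendsto_order]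
  refine ⟨fun u hu => ?_, fun u hu =>
    Eventually.of_forall fun t => (softmax_le_one _ _).trans_lt hu⟩
  filter_upwards [eventually_sum_softmax_le_mul
    (fun b hb => h b (Finset.ne_of_mem_erase hb)) (half_pos (sub_pos.2 hu))] with t ht
  rw [← one_sub_softmax] at ht
  nlinarith [softmax_le_one (x t) a]

lemma exists_not_summable_softmax [Nonempty (Fin K)] (x : ℕ → Fin K → ℝ) :
    ∃ a, ¬ Summable fun t => softmax (x t) a := by
  by_contra! h
  have hone : Summable fun t => ∑ a, softmax (x t) a := summable_sum fun a _ => h a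
  simp only [sum_softmax, summable_const_iff, one_ne_zero] at hone

lemma summable_softmax_of_bddAbove_of_bddBelow {x : ℕ → Fin K → ℝ} {a b : Fin K}
    (ha : BddAbove (Set.range fun t => x t a)) (hb : BddBelow (Set.range fun t => x t b))
    (hsum : Summable fun t => softmax (x t) b) : Summable fun t => softmax (x t) a := by
  obtain ⟨C, hC⟩ := ha
  obtain ⟨c, hc⟩ := hb
  refine Summable.of_nonneg_of_le (fun t => (softmax_pos _ _).le) (fun t => ?_)
    (hsum.mul_left (Real.exp (C - c)))
  rw [softmax_eq_exp_sub_mul_softmax (x t) a b]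
  exact mul_le_mul_of_nonneg_right
    (Real.exp_le_exp.2 (sub_le_sub (hC ⟨t, rfl⟩) (hc ⟨t, rfl⟩))) (softmax_pos _ _).le

end Softmax

section PolicyGradient

variable {K : ℕ}

/-- The partial derivative with respect to `θ a` of the expected reward `∑ b, softmax θ b * r b`
of the softmax policy; `η` times it is the drift of the gradient bandit algorithm. -/
noncomputable def policyGradient (r θ : Fin K → ℝ) (a : Fin K) : ℝ :=
  softmax θ a * (r a - ∑ b, softmax θ b * r b)

/-- The variance of the indicator that the softmax policy pulls the arm `a`. Up to a constant
factor, it bounds the conditional variance of the increments of the gradient bandit algorithm. -/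
noncomputable def pullVariance (θ : Fin K → ℝ) (a : Fin K) : ℝ :=
  softmax θ a * (1 - softmax θ a)

lemma pullVariance_nonneg (θ : Fin K → ℝ) (a : Fin K) : 0 ≤ pullVariance θ a :=
  mul_nonneg (softmax_pos _ _).le (sub_nonneg.2 (softmax_le_one _ _))

lemma pullVariance_le_softmax (θ : Fin K → ℝ) (a : Fin K) : pullVariance θ a ≤ softmax θ a :=
  mul_le_of_le_one_right (softmax_pos _ _).le (sub_le_self _ (softmax_pos _ _).le)

lemma sum_softmax_mul_sub (r θ : Fin K → ℝ) (a : Fin K) :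
    ∑ b, softmax θ b * (r a - r b) = r a - ∑ b, softmax θ b * r b := by
  have : Nonempty (Fin K) := ⟨a⟩
  simp only [mul_sub, Finset.sum_sub_distrib, ← Finset.sum_mul, sum_softmax, one_mul]

lemma mul_pullVariance_le_policyGradient {r : Fin K → ℝ} {a : Fin K} {c : ℝ}
    (h : ∀ b, b ≠ a → c ≤ r a - r b) (θ : Fin K → ℝ) :
    c * pullVariance θ a ≤ policyGradient r θ a := by
  rw [pullVariance, policyGradient, mul_left_comm, ← sum_softmax_mul_sub, one_sub_softmax,
    ← Finset.add_sum_erase _ _ (Finset.mem_univ a), sub_self, mul_zero, zero_add, Finset.mul_sum]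
  refine mul_le_mul_of_nonneg_left (Finset.sum_le_sum fun b hb => ?_) (softmax_pos _ _).le
  rw [mul_comm]
  exact mul_le_mul_of_nonneg_left (h b (Finset.ne_of_mem_erase hb)) (softmax_pos _ _).le

lemma policyGradient_le {r : Fin K → ℝ} {a : Fin K} {N : Finset (Fin K)} {c D : ℝ} (haN : a ∉ N)
    (hN : ∀ b ∈ N, r a - r b ≤ D) (hc : ∀ b ∉ N, b ≠ a → c ≤ r b - r a) (θ : Fin K → ℝ) :
    policyGradient r θ a ≤
      -(c * pullVariance θ a) + softmax θ a * ((c + D) * ∑ b ∈ N, softmax θ b) := by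
  have hterm : ∀ b ∈ Finset.univ.erase a, softmax θ b * (r a - r b) ≤
      -c * softmax θ b + if b ∈ N then (c + D) * softmax θ b else 0 := by
    intro b hb
    have hpos := softmax_pos θ b
    split_ifs with hbN
    · nlinarith [hN b hbN]
    · nlinarith [hc b hbN (Finset.ne_of_mem_erase hb)]
  have hNa : (Finset.univ.erase a).filter (· ∈ N) = N := by
    ext b
    simpa using fun hb : b ∈ N => ne_of_mem_of_not_mem hb haN
  have hadvantage : r a - ∑ b, softmax θ b * r b ≤
      -c * (1 - softmax θ a) + (c + D) * ∑ b ∈ N, softmax θ b := by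
    rw [← sum_softmax_mul_sub, ← Finset.add_sum_erase _ _ (Finset.mem_univ a), sub_self, mul_zero,
      zero_add]
    refine (Finset.sum_le_sum hterm).trans_eq ?_
    rw [Finset.sum_add_distrib, ← Finset.mul_sum, one_sub_softmax, ← Finset.sum_filter, hNa,
      Finset.mul_sum N]
  calc policyGradient r θ a
      ≤ softmax θ a * (-c * (1 - softmax θ a) + (c + D) * ∑ b ∈ N, softmax θ b) :=
        mul_le_mul_of_nonneg_left hadvantage (softmax_pos _ _).le
    _ = _ := by rw [pullVariance]; ring

lemma exists_pos_forall_pos_imp_le {ι : Type*} [Finite ι] (f : ι → ℝ) :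
    ∃ c > 0, ∀ i, 0 < f i → c ≤ f i := by
  have h : ∀ᶠ c in 𝓝[>] (0 : ℝ), ∀ i, 0 < f i → c ≤ f i :=
    eventually_all.2 fun i => eventually_imp_distrib_left.2 fun hi =>
      nhdsWithin_le_nhds (eventually_le_nhds hi)
  exact (eventually_mem_nhdsWithin.and h).exists

lemma exists_policyGradient_le {r : Fin K → ℝ} {a : Fin K} {N : Finset (Fin K)} (haN : a ∉ N)
    (hlt : ∀ b ∉ N, b ≠ a → r a < r b) : ∃ c > 0, ∃ M > 0, ∀ θ, policyGradient r θ a ≤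
      -(c * pullVariance θ a) + softmax θ a * (M * ∑ b ∈ N, softmax θ b) := by
  obtain ⟨c, hc, hgap⟩ := exists_pos_forall_pos_imp_le fun b => r b - r a
  obtain ⟨D, hD⟩ := Finite.exists_le fun b => r a - r b
  have hD0 : 0 ≤ D := by simpa using hD a
  exact ⟨c, hc, c + D, by positivity, policyGradient_le haN (fun b _ => hD b)
    fun b hb hba => hgap b (sub_pos.2 (hlt b hb hba))⟩

lemma exists_mul_pullVariance_le_policyGradient {r : Fin K → ℝ} {a : Fin K}
    (hlt : ∀ b, b ≠ a → r b < r a) : ∃ c > 0, ∀ θ, c * pullVariance θ a ≤ policyGradient r θ a := by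
  obtain ⟨c, hc, hgap⟩ := exists_pos_forall_pos_imp_le fun b => r a - r b
  exact ⟨c, hc, mul_pullVariance_le_policyGradient fun b hba => hgap b (sub_pos.2 (hlt b hba))⟩

end PolicyGradient

section Path

variable {K : ℕ} {η : ℝ} {r : Fin K → ℝ} {x : ℕ → Fin K → ℝ} {a : Fin K}

/-- The deterministic property of a path `x` of the gradient bandit algorithm with mean rewards `r`
from which convergence follows: each parameter tracks `η` times the policy gradient. -/
def TracksPolicyGradient (η : ℝ) (r : Fin K → ℝ) (x : ℕ → Fin K → ℝ) : Prop :=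
  ∀ a, TracksDrift (fun t => x t a) (fun t => η * policyGradient r (x t) a)
    fun t => pullVariance (x t) a

namespace TracksPolicyGradient

lemma bddBelow_of_summable (h : TracksPolicyGradient η r x) (hη : 0 < η)
    (ha : Summable fun t => softmax (x t) a) : BddBelow (Set.range fun t => x t a) := by
  obtain ⟨D, hD⟩ := Finite.exists_ge fun b => r a - r b
  have hV : Summable fun t => pullVariance (x t) a :=
    ha.of_nonneg_of_le (fun t => pullVariance_nonneg _ _) fun t => pullVariance_le_softmax _ _
  refine (h a).bddBelow (fun t => pullVariance_nonneg _ _) hη (hV.mul_left (η * (1 - D)))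
    (Eventually.of_forall fun t => ?_)
  calc η * pullVariance (x t) a - η * (1 - D) * pullVariance (x t) a
      = η * (D * pullVariance (x t) a) := by ring
    _ ≤ η * policyGradient r (x t) a := by
      gcongr
      exact mul_pullVariance_le_policyGradient (fun b _ => hD b) _

lemma bddAbove_of_summable (h : TracksPolicyGradient η r x) (hη : 0 < η) {N : Finset (Fin K)}
    (haN : a ∉ N) (hlt : ∀ b ∉ N, b ≠ a → r a < r b)
    (hN : ∀ b ∈ N, Summable fun t => softmax (x t) b) : BddAbove (Set.range fun t => x t a) := by
  obtain ⟨c, hc, M, hM, hdrift⟩ := exists_policyGradient_le haN hlt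
  refine (h a).bddAbove (fun t => pullVariance_nonneg _ _) (mul_pos hη hc)
    ((summable_sum hN).mul_left (η * M)) (Eventually.of_forall fun t => ?_)
  have hmass : 0 ≤ M * ∑ b ∈ N, softmax (x t) b :=
    mul_nonneg hM.le (Finset.sum_nonneg fun b _ => (softmax_pos _ _).le)
  calc η * policyGradient r (x t) a
      ≤ η * (-(c * pullVariance (x t) a) + M * ∑ b ∈ N, softmax (x t) b) := by
        gcongr
        exact (hdrift (x t)).trans
          (add_le_add_right (mul_le_of_le_one_left hmass (softmax_le_one _ _)) _)
    _ = -(η * c * pullVariance (x t) a) + η * M * ∑ b ∈ N, softmax (x t) b := by ring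

lemma not_summable_softmax (h : TracksPolicyGradient η r x) (hη : 0 < η)
    (hr : Function.Injective r) (a : Fin K) : ¬ Summable fun t => softmax (x t) a := by
  classical
  intro ha
  have : Nonempty (Fin K) := ⟨a⟩
  obtain ⟨i, hi, hworst⟩ := Set.exists_min_image {b | ¬ Summable fun t => softmax (x t) b} r
    (Set.toFinite _) (exists_not_summable_softmax x)
  set N : Finset (Fin K) := {b | Summable fun t => softmax (x t) b} with hN
  have habove : BddAbove (Set.range fun t => x t i) := by
    refine h.bddAbove_of_summable hη (N := N) (by simpa [hN] using hi) (fun b hb hbi => ?_)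
      fun b hb => (Finset.mem_filter.1 hb).2
    exact (hworst b (by simpa [hN] using hb)).lt_of_ne (hr.ne hbi.symm)
  exact hi (summable_softmax_of_bddAbove_of_bddBelow habove (h.bddBelow_of_summable hη ha) ha)

lemma tendsto_atTop_of_not_summable (h : TracksPolicyGradient η r x) (hη : 0 < η)
    (hbest : ∀ b, b ≠ a → r b < r a) (hV : ¬ Summable fun t => pullVariance (x t) a) :
    Tendsto (fun t => x t a) atTop atTop := by
  obtain ⟨c, hc, hdrift⟩ := exists_mul_pullVariance_le_policyGradient hbest
  refine (h a).tendsto_atTop (fun t => pullVariance_nonneg _ _) (mul_pos hη hc) hV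
    (Eventually.of_forall fun t => ?_)
  rw [mul_assoc]
  exact mul_le_mul_of_nonneg_left (hdrift (x t)) hη.le

lemma bddAbove_of_tendsto_sub_atBot (h : TracksPolicyGradient η r x) (hη : 0 < η)
    {N : Finset (Fin K)} {i : Fin K} (hia : i ≠ a) (haN : a ∉ N)
    (hlt : ∀ b ∉ N, b ≠ a → r a < r b)
    (hN : ∀ b ∈ N, Tendsto (fun t => x t b - x t i) atTop atBot) :
    BddAbove (Set.range fun t => x t a) := by
  obtain ⟨c, hc, M, hM, hdrift⟩ := exists_policyGradient_le haN hlt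
  refine (h a).bddAbove (fun t => pullVariance_nonneg _ _) (mul_pos hη (half_pos hc)) summable_zero
    ?_
  filter_upwards [eventually_sum_softmax_le_mul hN (δ := c / 2 / M) (by positivity)] with t ht
  have hmass : M * ∑ b ∈ N, softmax (x t) b ≤ c / 2 * (1 - softmax (x t) a) :=
    calc M * ∑ b ∈ N, softmax (x t) b ≤ M * (c / 2 / M * (1 - softmax (x t) a)) := by
          gcongr
          exact ht.trans (by gcongr; exact softmax_le_one_sub_softmax _ hia)
      _ = c / 2 * (1 - softmax (x t) a) := by field_simp
  calc η * policyGradient r (x t) a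
      ≤ η * (-(c * pullVariance (x t) a) + softmax (x t) a * (c / 2 * (1 - softmax (x t) a))) := by
        gcongr
        exact (hdrift (x t)).trans (by gcongr; exact (softmax_pos _ _).le)
    _ = -(η * (c / 2) * pullVariance (x t) a) + 0 := by rw [pullVariance]; ring

lemma tendsto_sub_atBot (h : TracksPolicyGradient η r x) (hη : 0 < η) (hr : Function.Injective r)
    (hbest : ∀ b, b ≠ a → r b < r a) (htop : Tendsto (fun t => x t a) atTop atTop)
    {b : Fin K} (hb : b ≠ a) : Tendsto (fun t => x t b - x t a) atTop atBot := by
  by_contra hbad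
  obtain ⟨i, ⟨hia, hi⟩, hworst⟩ := Set.exists_min_image
    {b | b ≠ a ∧ ¬ Tendsto (fun t => x t b - x t a) atTop atBot} r (Set.toFinite _) ⟨b, hb, hbad⟩
  have hbelow : ∀ j, r j < r i → Tendsto (fun t => x t j - x t a) atTop atBot := by
    intro j hji
    by_contra hj
    have hja : j ≠ a := by
      rintro rfl
      exact (hji.trans (hbest i hia)).false
    exact hji.not_ge (hworst j ⟨hja, hj⟩)
  obtain ⟨C, hC⟩ : BddAbove (Set.range fun t => x t i) := by
    refine h.bddAbove_of_tendsto_sub_atBot hη (N := {j | r j < r i}) (i := a) hia.symm (by simp)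
      (fun j hj hji => ?_) fun j hj => hbelow j (Finset.mem_filter.1 hj).2
    exact (not_lt.1 (by simpa using hj)).lt_of_ne (hr.ne hji.symm)
  refine hi (tendsto_atBot_mono (fun t => ?_)
    (tendsto_atBot_add_const_left _ C (tendsto_neg_atTop_atBot.comp htop)))
  exact sub_le_sub_right (hC ⟨t, rfl⟩) (x t a) |>.trans_eq (sub_eq_add_neg _ _)

theorem tendsto_softmax (h : TracksPolicyGradient η r x) (hη : 0 < η) (hr : Function.Injective r)
    {B : ℝ} (hB : ∀ t b, |x (t + 1) b - x t b| ≤ B) (hbest : ∀ b, b ≠ a → r b < r a) :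
    Tendsto (fun t => softmax (x t) a) atTop (𝓝 1) := by
  by_cases hV : Summable fun t => pullVariance (x t) a
  · exact tendsto_one_of_summable_mul_one_sub (fun t => (softmax_pos _ _).le)
      (fun t => softmax_le_one _ _) (Real.exp_pos _) (fun t => softmax_le_exp_mul_softmax (hB t) a)
      (h.not_summable_softmax hη hr a) hV
  · exact tendsto_softmax_one fun b hb =>
      h.tendsto_sub_atBot hη hr hbest (h.tendsto_atTop_of_not_summable hη hbest hV) hb

end TracksPolicyGradient

end Path

section Martingale

variable {Ω : Type*} {m mΩ : MeasurableSpace Ω} {μ : Measure Ω}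

lemma condVar_ae_nonneg (m : MeasurableSpace Ω) (X : Ω → ℝ) : 0 ≤ᵐ[μ] Var[X; μ | m] :=
  condExp_nonneg (Eventually.of_forall fun _ => sq_nonneg _)

lemma ae_abs_sub_condExp_le (m : MeasurableSpace Ω) {X : Ω → ℝ} {B : ℝ}
    (hB : ∀ᵐ ω ∂μ, |X ω| ≤ B) : ∀ᵐ ω ∂μ, |X ω - μ[X | m] ω| ≤ 2 * B := by
  filter_upwards [hB, ae_bdd_abs_condExp_of_ae_bdd_abs (m := m) hB] with ω hω hcond
  rw [two_mul]
  exact (abs_sub _ _).trans (add_le_add hω hcond)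

variable [IsFiniteMeasure μ] {ℱ : Filtration ℕ mΩ}

lemma ae_bddAbove_range_of_supermartingale {X : ℕ → Ω → ℝ} (hX : Supermartingale X ℱ μ)
    (hpos : 0 ≤ X) : ∀ᵐ ω ∂μ, BddAbove (Set.range fun n => X n ω) := by
  have hnorm : ∀ n, eLpNorm ((-X) n) 1 μ ≤ (∫ ω, X 0 ω ∂μ).toNNReal := by
    intro n
    rw [Pi.neg_apply, eLpNorm_neg, eLpNorm_one_eq_lintegral_enorm,
      ← ofReal_integral_norm_eq_lintegral_enorm (hX.integrable n)]
    simp only [Real.norm_of_nonneg (hpos n _)]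
    refine ENNReal.ofReal_le_ofReal ?_
    simpa only [setIntegral_univ] using hX.setIntegral_le n.zero_le MeasurableSet.univ
  filter_upwards [hX.neg.exists_ae_tendsto_of_bdd hnorm] with ω ⟨c, hc⟩
  simpa only [Pi.neg_apply, neg_neg] using hc.neg.bddAbove_range

lemma integrable_exp_of_ae_le {Z : Ω → ℝ} {B : ℝ} (hZ : AEStronglyMeasurable Z μ)
    (hB : ∀ᵐ ω ∂μ, Z ω ≤ B) : Integrable (fun ω => Real.exp (Z ω)) μ := by
  refine Integrable.of_bound (Real.continuous_exp.comp_aestronglyMeasurable hZ) (Real.exp B) ?_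
  filter_upwards [hB] with ω hω
  rwa [Real.norm_eq_abs, Real.abs_exp, Real.exp_le_exp]

lemma condExp_sub_condExp_ae_eq_zero (hm : m ≤ mΩ) {X : Ω → ℝ} (hX : Integrable X μ) :
    μ[X - μ[X | m] | m] =ᵐ[μ] 0 := by
  filter_upwards [condExp_sub hX integrable_condExp m] with ω hω
  rw [hω, condExp_of_stronglyMeasurable hm stronglyMeasurable_condExp integrable_condExp, sub_self]

lemma condExp_exp_sub_condExp_le (hm : m ≤ mΩ) {X : Ω → ℝ} (hX : Integrable X μ)
    (hb : ∀ᵐ ω ∂μ, |X ω - μ[X | m] ω| ≤ 1) :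
    μ[fun ω => Real.exp (X ω - μ[X | m] ω) | m] ≤ᵐ[μ]
      fun ω => Real.exp (Var[X; μ | m] ω) := by
  set Y : Ω → ℝ := X - μ[X | m] with hY
  have hYi : Integrable Y μ := hX.sub integrable_condExp
  have hY2 : Integrable (Y ^ 2) μ := by
    refine Integrable.of_bound (hYi.aestronglyMeasurable.pow 2) 1 ?_
    filter_upwards [hb] with ω hω
    simpa [hY] using hω
  have hexp : Integrable (fun ω => Real.exp (Y ω)) μ :=
    integrable_exp_of_ae_le hYi.aestronglyMeasurable (hb.mono fun ω hω => (le_abs_self _).trans hω)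
  have htaylor : (fun ω => Real.exp (Y ω)) ≤ᵐ[μ] (fun _ => 1) + Y + Y ^ 2 := by
    filter_upwards [hb] with ω hω
    have := (abs_le.1 (Real.abs_exp_sub_one_sub_id_le hω)).2
    simp only [Pi.add_apply, Pi.pow_apply, hY, Pi.sub_apply]
    linarith
  filter_upwards [condExp_mono (m := m) hexp (((integrable_const 1).add hYi).add hY2) htaylor,
    condExp_add ((integrable_const 1).add hYi) hY2 m, condExp_add (integrable_const 1) hYi m,
    condExp_sub_condExp_ae_eq_zero hm hX] with ω hle hadd hadd' hcentred
  calc μ[fun ω => Real.exp (Y ω) | m] ω ≤ Var[X; μ | m] ω + 1 := by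
        rw [hadd, Pi.add_apply, hadd', Pi.add_apply, hcentred, condExp_const hm] at hle
        exact hle.trans_eq (by rw [Pi.zero_apply, add_zero, add_comm]; rfl)
    _ ≤ Real.exp (Var[X; μ | m] ω) := Real.add_one_le_exp _

lemma condExp_exp_sub_condExp_sub_condVar_le_one (hm : m ≤ mΩ) {X : Ω → ℝ}
    (hX : Integrable X μ) (hb : ∀ᵐ ω ∂μ, |X ω - μ[X | m] ω| ≤ 1) :
    μ[fun ω => Real.exp (X ω - μ[X | m] ω - Var[X; μ | m] ω) | m] ≤ᵐ[μ] 1 := by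
  have hexp : Integrable (fun ω => Real.exp (X ω - μ[X | m] ω)) μ :=
    integrable_exp_of_ae_le (hX.sub integrable_condExp).aestronglyMeasurable
      (hb.mono fun ω hω => (le_abs_self _).trans hω)
  have hpull := condExp_stronglyMeasurable_mul_of_bound hm (μ := μ)
    (Real.continuous_exp.comp_stronglyMeasurable (stronglyMeasurable_condVar (X := X)).neg) hexp 1
    (by
      filter_upwards [condVar_ae_nonneg m X] with ω hω
      rw [Real.norm_eq_abs, Real.abs_exp, Real.exp_le_one_iff]
      exact neg_nonpos.2 hω)
  have hsplit : (fun ω => Real.exp (X ω - μ[X | m] ω - Var[X; μ | m] ω)) =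
      (fun ω => Real.exp ((-Var[X; μ | m]) ω)) * fun ω => Real.exp (X ω - μ[X | m] ω) := by
    ext ω
    simp only [Pi.mul_apply, Pi.neg_apply, ← Real.exp_add]
    ring_nf
  rw [hsplit]
  filter_upwards [hpull, condExp_exp_sub_condExp_le hm hX hb] with ω hω hle
  calc _ = Real.exp (-Var[X; μ | m] ω) * (μ[fun ω => Real.exp (X ω - μ[X | m] ω) | m]) ω := hω
    _ ≤ Real.exp (-Var[X; μ | m] ω) * Real.exp (Var[X; μ | m] ω) := by gcongr
    _ = 1 := by rw [← Real.exp_add, neg_add_cancel, Real.exp_zero]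

lemma supermartingale_exp_sum_range {Z : ℕ → Ω → ℝ} {B : ℝ}
    (hZ : ∀ i, StronglyMeasurable[ℱ (i + 1)] (Z i)) (hB : ∀ i, ∀ᵐ ω ∂μ, Z i ω ≤ B)
    (hexp : ∀ i, μ[fun ω => Real.exp (Z i ω) | ℱ i] ≤ᵐ[μ] 1) :
    Supermartingale (fun n ω => Real.exp (∑ i ∈ Finset.range n, Z i ω)) ℱ μ := by
  have hsum : StronglyAdapted ℱ fun n ω => ∑ i ∈ Finset.range n, Z i ω := fun n =>
    Finset.stronglyMeasurable_fun_sum _ fun i hi => (hZ i).mono (ℱ.mono (Finset.mem_range.1 hi))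
  have hint : ∀ n, Integrable (fun ω => Real.exp (∑ i ∈ Finset.range n, Z i ω)) μ := by
    refine fun n => integrable_exp_of_ae_le ((hsum n).mono (ℱ.le n)).aestronglyMeasurable
      (B := n • B) ?_
    filter_upwards [ae_all_iff.2 hB] with ω hω
    simpa using Finset.sum_le_card_nsmul (Finset.range n) _ B fun i _ => hω i
  refine supermartingale_nat (fun n => Real.continuous_exp.comp_stronglyMeasurable (hsum n)) hint
    fun n => ?_
  have hstep : (fun ω => Real.exp (∑ i ∈ Finset.range (n + 1), Z i ω)) =
      (fun ω => Real.exp (∑ i ∈ Finset.range n, Z i ω)) * fun ω => Real.exp (Z n ω) := by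
    ext ω
    rw [Finset.sum_range_succ, Real.exp_add, Pi.mul_apply]
  rw [hstep]
  filter_upwards [condExp_mul_of_stronglyMeasurable_left (μ := μ)
    (Real.continuous_exp.comp_stronglyMeasurable (hsum n)) (hstep ▸ hint (n + 1))
    (integrable_exp_of_ae_le ((hZ n).mono (ℱ.le _)).aestronglyMeasurable (hB n)), hexp n]
    with ω hω hle
  exact hω.trans_le (mul_le_of_le_one_right (Real.exp_pos _).le hle)

lemma ae_bddAbove_range_sum_of_condExp_exp_le_one {Z : ℕ → Ω → ℝ} {B : ℝ}
    (hZ : ∀ i, StronglyMeasurable[ℱ (i + 1)] (Z i)) (hB : ∀ i, ∀ᵐ ω ∂μ, Z i ω ≤ B)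
    (hexp : ∀ i, μ[fun ω => Real.exp (Z i ω) | ℱ i] ≤ᵐ[μ] 1) :
    ∀ᵐ ω ∂μ, BddAbove (Set.range fun n => ∑ i ∈ Finset.range n, Z i ω) := by
  filter_upwards [ae_bddAbove_range_of_supermartingale (supermartingale_exp_sum_range hZ hB hexp)
    fun _ _ => (Real.exp_pos _).le] with ω ⟨C, hC⟩
  refine ⟨C, Set.forall_mem_range.2 fun n => ?_⟩
  calc ∑ i ∈ Finset.range n, Z i ω ≤ ∑ i ∈ Finset.range n, Z i ω + 1 := (lt_add_one _).le
    _ ≤ Real.exp (∑ i ∈ Finset.range n, Z i ω) := Real.add_one_le_exp _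
    _ ≤ C := hC ⟨n, rfl⟩

variable {X : ℕ → Ω → ℝ} {B : ℝ}

lemma ae_bddAbove_range_sum_sub_condExp_sub_condVar
    (hX : ∀ i, StronglyMeasurable[ℱ (i + 1)] (X i)) (hB : ∀ i, ∀ᵐ ω ∂μ, |X i ω| ≤ 1 / 2) :
    ∀ᵐ ω ∂μ, BddAbove (Set.range fun n => ∑ i ∈ Finset.range n,
      (X i ω - μ[X i | ℱ i] ω - Var[X i; μ | ℱ i] ω)) := by
  have hcentred : ∀ i, ∀ᵐ ω ∂μ, |X i ω - μ[X i | ℱ i] ω| ≤ 1 := fun i => by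
    simpa using ae_abs_sub_condExp_le (ℱ i) (hB i)
  refine ae_bddAbove_range_sum_of_condExp_exp_le_one (B := 1) (fun i => ?_) (fun i => ?_)
    fun i => condExp_exp_sub_condExp_sub_condVar_le_one (ℱ.le i)
      (Integrable.of_bound ((hX i).mono (ℱ.le _)).aestronglyMeasurable _ (hB i)) (hcentred i)
  · exact ((hX i).sub (stronglyMeasurable_condExp.mono (ℱ.mono i.le_succ))).sub
      (stronglyMeasurable_condVar.mono (ℱ.mono i.le_succ))
  · filter_upwards [hcentred i, condVar_ae_nonneg (ℱ i) (X i)] with ω hω hvar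
    exact (sub_le_self _ hvar).trans ((le_abs_self _).trans hω)

/-- The exponential supermartingale controls `l • X` by its own conditional variance, which has a
factor `l ^ 2`; dividing by a small `l` gives the factor `ε`. -/
lemma ae_exists_sum_sub_condExp_le (hX : ∀ i, StronglyMeasurable[ℱ (i + 1)] (X i))
    (hB : ∀ i, ∀ᵐ ω ∂μ, |X i ω| ≤ B) {ε : ℝ} (hε : 0 < ε) :
    ∀ᵐ ω ∂μ, ∃ C, ∀ n, ∑ i ∈ Finset.range n, (X i ω - μ[X i | ℱ i] ω) ≤
      C + ε * ∑ i ∈ Finset.range n, Var[X i; μ | ℱ i] ω := by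
  obtain ⟨l, hl0, hlε, hlB⟩ : ∃ l > 0, l ≤ ε ∧ l * B ≤ 1 / 2 := by
    have hlim : Tendsto (fun l => l * B) (𝓝[>] (0 : ℝ)) (𝓝 0) := by
      simpa using ((continuous_mul_const B).tendsto 0).mono_left nhdsWithin_le_nhds
    have hle : ∀ᶠ l in 𝓝[>] (0 : ℝ), l ≤ ε := nhdsWithin_le_nhds (eventually_le_nhds hε)
    exact (eventually_mem_nhdsWithin.and
      (hle.and (hlim.eventually_le_const one_half_pos))).exists
  have hlX : ∀ i, ∀ᵐ ω ∂μ, |(l • X i) ω| ≤ 1 / 2 := fun i => by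
    filter_upwards [hB i] with ω hω
    rw [Pi.smul_apply, smul_eq_mul, abs_mul, abs_of_pos hl0]
    exact (mul_le_mul_of_nonneg_left hω hl0.le).trans hlB
  filter_upwards [ae_bddAbove_range_sum_sub_condExp_sub_condVar (fun i => (hX i).const_smul l) hlX,
    ae_all_iff.2 fun i => condExp_smul l (X i) (ℱ i),
    ae_all_iff.2 fun i => condVar_smul (m := ℱ i) l (X i),
    ae_all_iff.2 fun i => condVar_ae_nonneg (ℱ i) (X i)] with ω ⟨C, hC⟩ hcond hvar hnonneg
  refine ⟨C / l, fun n => ?_⟩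
  have hscaled : l * (∑ i ∈ Finset.range n, (X i ω - μ[X i | ℱ i] ω) -
      l * ∑ i ∈ Finset.range n, Var[X i; μ | ℱ i] ω) ≤ C := by
    refine (hC ⟨n, rfl⟩).trans_eq' ?_
    simp only [hcond, hvar, Pi.smul_apply, smul_eq_mul, Finset.mul_sum, mul_sub,
      ← Finset.sum_sub_distrib]
    ring_nf
  rw [mul_comm, ← le_div_iff₀ hl0, sub_le_iff_le_add] at hscaled
  refine hscaled.trans ?_
  gcongr
  exact Finset.sum_nonneg fun i _ => hnonneg i

lemma ae_forall_exists_sum_sub_condExp_le (hX : ∀ i, StronglyMeasurable[ℱ (i + 1)] (X i))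
    (hB : ∀ i, ∀ᵐ ω ∂μ, |X i ω| ≤ B) :
    ∀ᵐ ω ∂μ, ∀ ε > 0, ∃ C, ∀ n, ∑ i ∈ Finset.range n, (X i ω - μ[X i | ℱ i] ω) ≤
      C + ε * ∑ i ∈ Finset.range n, Var[X i; μ | ℱ i] ω := by
  filter_upwards [ae_all_iff.2 fun k : ℕ => ae_exists_sum_sub_condExp_le hX hB
      (Nat.one_div_pos_of_nat (α := ℝ) (n := k)),
    ae_all_iff.2 fun i => condVar_ae_nonneg (ℱ i) (X i)] with ω hω hnonneg ε hε
  obtain ⟨k, hk⟩ := exists_nat_one_div_lt hε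
  obtain ⟨C, hC⟩ := hω k
  refine ⟨C, fun n => (hC n).trans ?_⟩
  gcongr
  exact Finset.sum_nonneg fun i _ => hnonneg i

theorem ae_tracksDrift (hX : ∀ i, StronglyMeasurable[ℱ (i + 1)] (X i))
    (hB : ∀ i, ∀ᵐ ω ∂μ, |X i ω| ≤ B) :
    ∀ᵐ ω ∂μ, TracksDrift (fun n => ∑ i ∈ Finset.range n, X i ω) (fun i => μ[X i | ℱ i] ω)
      fun i => Var[X i; μ | ℱ i] ω := by
  filter_upwards [ae_forall_exists_sum_sub_condExp_le hX hB,
    ae_forall_exists_sum_sub_condExp_le (X := -X) (fun i => (hX i).neg)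
      (fun i => (hB i).mono fun ω hω => (abs_neg (X i ω)).trans_le hω),
    ae_all_iff.2 fun i => condExp_neg (X i) (ℱ i),
    ae_all_iff.2 fun i => condVar_neg (m := ℱ i) (μ := μ) (X i)]
    with ω hupper hlower hcond hvar ε hε
  obtain ⟨C₁, hC₁⟩ := hupper ε hε
  obtain ⟨C₂, hC₂⟩ := hlower ε hε
  refine ⟨max C₁ C₂, fun n => ?_⟩
  rw [← Finset.sum_sub_distrib, abs_le']
  constructor
  · exact (hC₁ n).trans (by gcongr; exact le_max_left _ _)
  · have hlower_n := hC₂ n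
    simp only [Pi.neg_apply, hcond, hvar, ← neg_sub', Finset.sum_neg_distrib] at hlower_n
    exact hlower_n.trans (by gcongr; exact le_max_right _ _)

end Martingale

section ConditionalLaw

variable {Ω 𝓧 : Type*} {m mΩ : MeasurableSpace Ω} [MeasurableSpace 𝓧] {μ : Measure Ω}
  {ν : Measure 𝓧} [IsProbabilityMeasure ν] {S : Set Ω} {X : Ω → 𝓧} {p : Ω → ℝ}

lemma condExp_indicator_one_of_condLaw
    (h : ∀ B, MeasurableSet B →
      μ[(S ∩ X ⁻¹' B).indicator (fun _ => (1 : ℝ)) | m] =ᵐ[μ] fun ω => p ω * ν.real B) :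
    μ[S.indicator (fun _ => (1 : ℝ)) | m] =ᵐ[μ] p := by
  simpa using h Set.univ MeasurableSet.univ

variable [IsFiniteMeasure μ]

lemma map_restrict_inter_of_condLaw (hm : m ≤ mΩ) (hS : MeasurableSet S) (hX : Measurable X)
    (h : ∀ B, MeasurableSet B →
      μ[(S ∩ X ⁻¹' B).indicator (fun _ => (1 : ℝ)) | m] =ᵐ[μ] fun ω => p ω * ν.real B)
    {T : Set Ω} (hT : MeasurableSet[m] T) :
    (μ.restrict (T ∩ S)).map X = μ (T ∩ S) • ν := by
  have hreal : ∀ B, MeasurableSet B →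
      μ.real (T ∩ (S ∩ X ⁻¹' B)) = (∫ ω in T, p ω ∂μ) * ν.real B := by
    intro B hB
    have hmeas : MeasurableSet (S ∩ X ⁻¹' B) := hS.inter (hX hB)
    rw [← integral_mul_const, ← setIntegral_congr_ae (hm _ hT) ((h B hB).mono fun ω hω _ => hω),
      setIntegral_condExp hm ((integrable_const _).indicator hmeas) hT,
      setIntegral_indicator hmeas, setIntegral_const, smul_eq_mul, mul_one]
  have huniv : μ.real (T ∩ S) = ∫ ω in T, p ω ∂μ := by
    simpa using hreal Set.univ MeasurableSet.univ
  ext B hB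
  rw [Measure.map_apply hX hB, Measure.restrict_apply (hX hB), Measure.smul_apply, smul_eq_mul,
    ← ENNReal.toReal_eq_toReal_iff' (measure_ne_top _ _) (by finiteness), ENNReal.toReal_mul,
    Set.inter_comm, Set.inter_assoc]
  exact (hreal B hB).trans (by rw [← huniv]; rfl)

lemma ae_imp_of_condLaw (hm : m ≤ mΩ) (hS : MeasurableSet S) (hX : Measurable X)
    (h : ∀ B, MeasurableSet B →
      μ[(S ∩ X ⁻¹' B).indicator (fun _ => (1 : ℝ)) | m] =ᵐ[μ] fun ω => p ω * ν.real B)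
    {Q : 𝓧 → Prop} (hQ : ∀ᵐ x ∂ν, Q x) : ∀ᵐ ω ∂μ, ω ∈ S → Q (X ω) := by
  rw [← ae_restrict_iff' hS]
  refine ae_of_ae_map hX.aemeasurable ?_
  have hmap := map_restrict_inter_of_condLaw hm hS hX h MeasurableSet.univ
  rw [Set.univ_inter] at hmap
  rw [hmap]
  exact Measure.ae_smul_measure hQ _

lemma condExp_indicator_comp_of_condLaw {E : Type*} [NormedAddCommGroup E] [NormedSpace ℝ E]
    [CompleteSpace E] (hm : m ≤ mΩ) (hS : MeasurableSet S) (hX : Measurable X)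
    (h : ∀ B, MeasurableSet B →
      μ[(S ∩ X ⁻¹' B).indicator (fun _ => (1 : ℝ)) | m] =ᵐ[μ] fun ω => p ω * ν.real B)
    {g : 𝓧 → E} (hg : Integrable g ν) :
    μ[S.indicator (g ∘ X) | m] =ᵐ[μ] fun ω => p ω • ∫ x, g x ∂ν := by
  have hp := condExp_indicator_one_of_condLaw h
  have hmap := fun {T} hT => map_restrict_inter_of_condLaw (T := T) hm hS hX h hT
  have hgX : ∀ {T}, MeasurableSet[m] T → Integrable g ((μ.restrict (T ∩ S)).map X) := fun hT =>
    hmap hT ▸ hg.smul_measure (measure_ne_top _ _)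
  have hint : Integrable (S.indicator (g ∘ X)) μ := by
    have := (hgX MeasurableSet.univ).comp_measurable hX
    rw [Set.univ_inter] at this
    exact (integrable_indicator_iff hS).2 this
  have hpint : Integrable p μ := integrable_condExp.congr hp
  refine (ae_eq_condExp_of_forall_setIntegral_eq hm hint
    (fun T _ _ => (hpint.smul_const _).integrableOn) (fun T hT _ => ?_)
    ((stronglyMeasurable_condExp.aestronglyMeasurable.congr hp).smul_const _)).symm
  calc ∫ ω in T, p ω • ∫ x, g x ∂ν ∂μ
      = (∫ ω in T, p ω ∂μ) • ∫ x, g x ∂ν := integral_smul_const _ _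
    _ = μ.real (T ∩ S) • ∫ x, g x ∂ν := by
        rw [← setIntegral_congr_ae (hm _ hT) (hp.mono fun ω hω _ => hω),
          setIntegral_condExp hm ((integrable_const _).indicator hS) hT,
          setIntegral_indicator hS, setIntegral_const, smul_eq_mul, mul_one]
    _ = ∫ x, g x ∂(μ.restrict (T ∩ S)).map X := by
        rw [hmap hT, integral_smul_measure]
        rfl
    _ = ∫ ω in T ∩ S, g (X ω) ∂μ :=
        integral_map hX.aemeasurable (hgX hT).aestronglyMeasurable
    _ = ∫ ω in T, S.indicator (g ∘ X) ω ∂μ := (setIntegral_indicator hS).symm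

end ConditionalLaw

section ConditionalVariance

variable {Ω : Type*} {m mΩ : MeasurableSpace Ω} {μ : Measure Ω} [IsFiniteMeasure μ]

lemma condVar_indicator_one (hm : m ≤ mΩ) {S : Set Ω} (hS : MeasurableSet S) :
    Var[S.indicator fun _ => (1 : ℝ); μ | m] =ᵐ[μ] fun ω =>
      μ[S.indicator fun _ => (1 : ℝ) | m] ω * (1 - μ[S.indicator fun _ => (1 : ℝ) | m] ω) := by
  have hsq : (S.indicator fun _ => (1 : ℝ)) ^ 2 = S.indicator fun _ => (1 : ℝ) := by
    ext ω
    by_cases hω : ω ∈ S <;> simp [hω]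
  filter_upwards [condVar_ae_eq_condExp_sq_sub_sq_condExp hm
    ((memLp_const (1 : ℝ)).indicator hS)] with ω hω
  rw [hω, hsq, Pi.sub_apply, Pi.pow_apply]
  ring

lemma condVar_mul_le_of_ae_abs_le (hm : m ≤ mΩ) {X Y : Ω → ℝ} {B : ℝ} (hX : MemLp X 2 μ)
    (hY : AEStronglyMeasurable Y μ) (hB : ∀ᵐ ω ∂μ, |Y ω| ≤ B) :
    Var[X * Y; μ | m] ≤ᵐ[μ] fun ω => B ^ 2 * μ[X ^ 2 | m] ω := by
  have hXY : MemLp (X * Y) 2 μ := by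
    refine hX.of_le_mul (c := B) (hX.aestronglyMeasurable.mul hY) ?_
    filter_upwards [hB] with ω hω
    rw [Pi.mul_apply, norm_mul, mul_comm]
    exact mul_le_mul_of_nonneg_right hω (norm_nonneg _)
  have hle : (X * Y) ^ 2 ≤ᵐ[μ] B ^ 2 • X ^ 2 := by
    filter_upwards [hB] with ω hω
    simp only [Pi.pow_apply, Pi.mul_apply, Pi.smul_apply, smul_eq_mul, mul_pow]
    rw [mul_comm]
    exact mul_le_mul_of_nonneg_right (sq_le_sq' (abs_le.1 hω).1 (abs_le.1 hω).2) (sq_nonneg _)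
  filter_upwards [condVar_ae_le_condExp_sq hm hXY,
    condExp_mono (m := m) hXY.integrable_sq (hX.integrable_sq.smul (B ^ 2)) hle,
    condExp_smul (B ^ 2) (X ^ 2) m] with ω hvar hmono hsmul
  exact hvar.trans (hmono.trans_eq hsmul)

end ConditionalVariance

lemma gradientBanditUpdate_sub_apply {K : ℕ} (η : ℝ) (θ : Fin K → ℝ) (b : Fin K) (x : ℝ)
    (a : Fin K) : gradientBanditUpdate η θ b x a - θ a =
      η * ((({a} : Set (Fin K)).indicator (fun _ => 1) b - softmax θ a) * x) := by
  by_cases h : a = b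
  · simp [gradientBanditUpdate, h, mul_assoc]
  · have hb : b ∉ ({a} : Set (Fin K)) := Ne.symm h
    rw [gradientBanditUpdate, if_neg h, Set.indicator_of_notMem hb]
    ring

lemma measurable_gradientBanditUpdate {K : ℕ} (η : ℝ) :
    Measurable fun y : (Fin K → ℝ) × Fin K × ℝ => gradientBanditUpdate η y.1 y.2.1 y.2.2 := by
  refine measurable_pi_lambda _ fun a => ?_
  have hsoftmax : Measurable fun y : (Fin K → ℝ) × Fin K × ℝ => softmax y.1 a :=
    (measurable_softmax a).comp measurable_fst
  exact Measurable.ite (measurableSet_eq_fun measurable_const (by fun_prop)) (by fun_prop)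
    (by fun_prop)

namespace IsGradientBanditRun

variable {Ω : Type*} {mΩ : MeasurableSpace Ω} {P : Measure Ω} {ℱ : Filtration ℕ mΩ} {K : ℕ}
  {ν : Fin K → Measure ℝ} {Rmax η : ℝ} {θ : ℕ → Ω → Fin K → ℝ} {A : ℕ → Ω → Fin K} {R : ℕ → Ω → ℝ}

lemma measurable_param (run : IsGradientBanditRun P ℱ ν η θ A R) (t : ℕ) :
    Measurable[ℱ t] (θ t) := by
  induction t with
  | zero => exact run.measurable_init
  | succ t ih =>
    have hpast : Measurable[ℱ (t + 1)] (θ t) := ih.mono (ℱ.mono t.le_succ) le_rfl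
    rw [funext (run.update t)]
    exact (measurable_gradientBanditUpdate η).comp
      (hpast.prodMk ((run.measurable_arm t).prodMk (run.measurable_reward t)))

lemma stronglyMeasurable_softmax (run : IsGradientBanditRun P ℱ ν η θ A R) (t : ℕ) (a : Fin K) :
    StronglyMeasurable[ℱ t] fun ω => softmax (θ t ω) a :=
  ((measurable_softmax a).comp (run.measurable_param t)).stronglyMeasurable

lemma stronglyMeasurable_increment (run : IsGradientBanditRun P ℱ ν η θ A R) (t : ℕ) (a : Fin K) :
    StronglyMeasurable[ℱ (t + 1)] fun ω => θ (t + 1) ω a - θ t ω a := by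
  have hparam : ∀ s, Measurable[ℱ s] fun ω => θ s ω a := fun s =>
    (measurable_pi_apply a).comp (run.measurable_param s)
  exact ((hparam (t + 1)).sub ((hparam t).mono (ℱ.mono t.le_succ) le_rfl)).stronglyMeasurable

lemma measurableSet_arm (run : IsGradientBanditRun P ℱ ν η θ A R) (t : ℕ) (a : Fin K) :
    MeasurableSet (A t ⁻¹' {a}) :=
  ℱ.le (t + 1) _ (run.measurable_arm t (measurableSet_singleton a))

lemma measurable_reward_ambient (run : IsGradientBanditRun P ℱ ν η θ A R) (t : ℕ) :
    Measurable (R t) :=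
  (run.measurable_reward t).mono (ℱ.le _) le_rfl

lemma increment_eq (run : IsGradientBanditRun P ℱ ν η θ A R) (t : ℕ) (a : Fin K) (ω : Ω) :
    θ (t + 1) ω a - θ t ω a =
      η * (((A t ⁻¹' {a}).indicator (fun _ => 1) ω - softmax (θ t ω) a) * R t ω) := by
  rw [run.update, gradientBanditUpdate_sub_apply]
  rfl

variable [∀ a, IsProbabilityMeasure (ν a)]

lemma condExp_indicator_arm (run : IsGradientBanditRun P ℱ ν η θ A R) (t : ℕ) (a : Fin K) :
    P[(A t ⁻¹' {a}).indicator (fun _ => (1 : ℝ)) | ℱ t] =ᵐ[P] fun ω => softmax (θ t ω) a :=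
  condExp_indicator_one_of_condLaw (run.condLaw t a)

variable [IsFiniteMeasure P]

lemma ae_abs_reward_le (run : IsGradientBanditRun P ℱ ν η θ A R)
    (hν : ∀ a, ∀ᵐ x ∂(ν a), x ∈ Set.Icc (-Rmax) Rmax) (t : ℕ) : ∀ᵐ ω ∂P, |R t ω| ≤ Rmax := by
  filter_upwards [ae_all_iff.2 fun a => ae_imp_of_condLaw (ℱ.le t) (run.measurableSet_arm t a)
    (run.measurable_reward_ambient t) (run.condLaw t a) (hν a)] with ω hω
  exact abs_le.2 (hω (A t ω) rfl)

lemma integrable_reward (run : IsGradientBanditRun P ℱ ν η θ A R)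
    (hν : ∀ a, ∀ᵐ x ∂(ν a), x ∈ Set.Icc (-Rmax) Rmax) (t : ℕ) : Integrable (R t) P :=
  Integrable.of_bound (run.measurable_reward_ambient t).aestronglyMeasurable Rmax
    (run.ae_abs_reward_le hν t)

lemma ae_abs_increment_le (run : IsGradientBanditRun P ℱ ν η θ A R)
    (hν : ∀ a, ∀ᵐ x ∂(ν a), x ∈ Set.Icc (-Rmax) Rmax) (t : ℕ) :
    ∀ᵐ ω ∂P, ∀ a, |θ (t + 1) ω a - θ t ω a| ≤ |η| * Rmax := by
  filter_upwards [run.ae_abs_reward_le hν t] with ω hω a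
  have hcoeff : |(A t ⁻¹' {a}).indicator (fun _ => 1) ω - softmax (θ t ω) a| ≤ 1 :=
    abs_sub_le_of_nonneg_of_le (Set.indicator_nonneg (fun _ _ => zero_le_one) ω)
      (Set.indicator_le_self' (fun _ _ => zero_le_one) ω) (softmax_pos _ _).le (softmax_le_one _ _)
  rw [run.increment_eq, abs_mul, abs_mul]
  exact mul_le_mul_of_nonneg_left ((mul_le_of_le_one_left (abs_nonneg _) hcoeff).trans hω)
    (abs_nonneg _)

lemma condExp_indicator_arm_reward (run : IsGradientBanditRun P ℱ ν η θ A R)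
    (hν : ∀ a, ∀ᵐ x ∂(ν a), x ∈ Set.Icc (-Rmax) Rmax) (t : ℕ) (a : Fin K) :
    P[(A t ⁻¹' {a}).indicator (R t) | ℱ t] =ᵐ[P] fun ω => softmax (θ t ω) a * meanReward ν a :=
  condExp_indicator_comp_of_condLaw (g := id) (ℱ.le t) (run.measurableSet_arm t a)
    (run.measurable_reward_ambient t) (run.condLaw t a)
    (Integrable.of_bound aestronglyMeasurable_id Rmax ((hν a).mono fun _ => abs_le.2))

lemma condExp_reward (run : IsGradientBanditRun P ℱ ν η θ A R)
    (hν : ∀ a, ∀ᵐ x ∂(ν a), x ∈ Set.Icc (-Rmax) Rmax) (t : ℕ) :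
    P[R t | ℱ t] =ᵐ[P] fun ω => ∑ b, softmax (θ t ω) b * meanReward ν b := by
  have hsum : R t = ∑ b, (A t ⁻¹' {b}).indicator (R t) := by
    ext ω
    rw [Finset.sum_apply, Finset.sum_eq_single (A t ω)
      (fun b _ hb => Set.indicator_of_notMem (s := A t ⁻¹' {b}) hb.symm _) (by simp),
      Set.indicator_of_mem (s := A t ⁻¹' {A t ω}) rfl]
  rw [hsum]
  refine (condExp_finsetSum
    (fun b _ => (run.integrable_reward hν t).indicator (run.measurableSet_arm t b)) _).trans ?_
  filter_upwards [ae_all_iff.2 fun b => run.condExp_indicator_arm_reward hν t b] with ω hω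
  simp only [Finset.sum_apply, hω]

lemma condExp_increment (run : IsGradientBanditRun P ℱ ν η θ A R)
    (hν : ∀ a, ∀ᵐ x ∂(ν a), x ∈ Set.Icc (-Rmax) Rmax) (t : ℕ) (a : Fin K) :
    P[fun ω => θ (t + 1) ω a - θ t ω a | ℱ t] =ᵐ[P]
      fun ω => η * policyGradient (meanReward ν) (θ t ω) a := by
  set p : Ω → ℝ := fun ω => softmax (θ t ω) a
  have hp : ∀ᵐ ω ∂P, ‖p ω‖ ≤ 1 := Eventually.of_forall fun ω => by
    rw [Real.norm_of_nonneg (softmax_pos _ _).le]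
    exact softmax_le_one _ _
  have hR := run.integrable_reward hν t
  have hpR : Integrable (p * R t) P :=
    hR.bdd_mul ((run.stronglyMeasurable_softmax t a).mono (ℱ.le t)).aestronglyMeasurable hp
  have hincrement : (fun ω => θ (t + 1) ω a - θ t ω a) =
      η • ((A t ⁻¹' {a}).indicator (R t) - p * R t) := by
    ext ω
    rw [run.increment_eq]
    by_cases hω : ω ∈ A t ⁻¹' {a} <;> simp [p, hω, sub_mul]
  rw [hincrement]
  filter_upwards [condExp_smul η ((A t ⁻¹' {a}).indicator (R t) - p * R t) (ℱ t),
    condExp_sub (hR.indicator (run.measurableSet_arm t a)) hpR (ℱ t),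
    condExp_stronglyMeasurable_mul_of_bound (ℱ.le t) (run.stronglyMeasurable_softmax t a) hR 1 hp,
    run.condExp_indicator_arm_reward hν t a, run.condExp_reward hν t]
    with ω hsmul hsub hmul harm hreward
  rw [hsmul, Pi.smul_apply, hsub, Pi.sub_apply, hmul, Pi.mul_apply, harm, hreward, policyGradient,
    smul_eq_mul, mul_sub (softmax _ _)]

lemma condVar_increment_le (run : IsGradientBanditRun P ℱ ν η θ A R)
    (hν : ∀ a, ∀ᵐ x ∂(ν a), x ∈ Set.Icc (-Rmax) Rmax) (t : ℕ) (a : Fin K) :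
    Var[fun ω => θ (t + 1) ω a - θ t ω a; P | ℱ t] ≤ᵐ[P]
      fun ω => (η * Rmax) ^ 2 * pullVariance (θ t ω) a := by
  set u : Ω → ℝ := (A t ⁻¹' {a}).indicator fun _ => 1
  have hu : MemLp u 2 P := (memLp_const 1).indicator (run.measurableSet_arm t a)
  have hincrement : (fun ω => θ (t + 1) ω a - θ t ω a) =ᵐ[P] η • ((u - P[u | ℱ t]) * R t) := by
    filter_upwards [run.condExp_indicator_arm t a] with ω hω
    simp only [run.increment_eq, Pi.smul_apply, Pi.mul_apply, Pi.sub_apply, smul_eq_mul, u, hω]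
  filter_upwards [condVar_congr_ae (m := ℱ t) hincrement,
    condVar_smul (m := ℱ t) (μ := P) η ((u - P[u | ℱ t]) * R t),
    condVar_mul_le_of_ae_abs_le (ℱ.le t) (hu.sub (hu.condExp one_le_two))
      (run.measurable_reward_ambient t).aestronglyMeasurable (run.ae_abs_reward_le hν t),
    condVar_indicator_one (μ := P) (ℱ.le t) (run.measurableSet_arm t a),
    run.condExp_indicator_arm t a] with ω hcongr hsmul hle hvar hp
  calc Var[fun ω => θ (t + 1) ω a - θ t ω a; P | ℱ t] ω
      = η ^ 2 * Var[(u - P[u | ℱ t]) * R t; P | ℱ t] ω := hcongr.trans hsmul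
    _ ≤ η ^ 2 * (Rmax ^ 2 * Var[u; P | ℱ t] ω) := by gcongr; exact hle
    _ = (η * Rmax) ^ 2 * pullVariance (θ t ω) a := by
        rw [hvar, hp, pullVariance]
        ring

theorem ae_tracksPolicyGradient (run : IsGradientBanditRun P ℱ ν η θ A R)
    (hν : ∀ a, ∀ᵐ x ∂(ν a), x ∈ Set.Icc (-Rmax) Rmax) (hηR : 0 < (η * Rmax) ^ 2) :
    ∀ᵐ ω ∂P, TracksPolicyGradient η (meanReward ν) fun t => θ t ω := by
  refine ae_all_iff.2 fun a => ?_
  filter_upwards [ae_tracksDrift (run.stronglyMeasurable_increment · a)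
      (fun t => (run.ae_abs_increment_le hν t).mono fun ω hω => hω a),
    ae_all_iff.2 fun t => run.condExp_increment hν t a,
    ae_all_iff.2 fun t => run.condVar_increment_le hν t a] with ω htracks hdrift hvar
  have hsum := (htracks.mono_variance hηR hvar).const_add (θ 0 ω a)
  simpa only [Finset.sum_range_sub (θ · ω a), add_sub_cancel, hdrift] using hsum

end IsGradientBanditRun

theorem theorem2 {Ω : Type*} {mΩ : MeasurableSpace Ω} (P : Measure Ω) [IsProbabilityMeasure P]
    (ℱ : Filtration ℕ mΩ) {K : ℕ} (hK : 2 ≤ K)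
    (ν : Fin K → Measure ℝ) [∀ a, IsProbabilityMeasure (ν a)]
    (Rmax : ℝ) (hRmax : 0 < Rmax) (hν : ∀ a, ∀ᵐ x ∂(ν a), x ∈ Set.Icc (-Rmax) Rmax)
    (no_ties : ∀ i j : Fin K, i ≠ j → meanReward ν i ≠ meanReward ν j)
    (η : ℝ) (hη : 0 < η)
    (θ : ℕ → Ω → Fin K → ℝ) (A : ℕ → Ω → Fin K) (R : ℕ → Ω → ℝ)
    (run : IsGradientBanditRun P ℱ ν η θ A R)
    (astar : Fin K) (optimal : ∀ a, meanReward ν a ≤ meanReward ν astar) :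
    ∀ᵐ ω ∂P, Tendsto (fun t => softmax (θ t ω) astar) atTop (𝓝 1) := by
  have hinj : Function.Injective (meanReward ν) := Function.injective_iff_pairwise_ne.2 no_ties
  have hbest : ∀ b, b ≠ astar → meanReward ν b < meanReward ν astar := fun b hb =>
    (optimal b).lt_of_ne (no_ties b astar hb)
  filter_upwards [run.ae_tracksPolicyGradient hν (by positivity),
    ae_all_iff.2 (run.ae_abs_increment_le hν)] with ω htracks hincrement
  exact htracks.tendsto_softmax hη hinj hincrement hbest
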